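/- Theorem ($(1+\epsilon)$ Undirected Weighted Preservers). Let $G=(V,E)$ be a finite simple undirected graph with edge weights $w:E\to[0,\infty)$, and let $\mathrm{dist}_G(u,v)$ denote the minimum total weight of a $u$-$v$ path in $G$ (with $\mathrm{dist}_G(u,v)=\infty$ if there is no such path). For a set $P\subseteq V\times V$ and $\epsilon>0$, a $(1+\epsilon)$-preserver of $G$ for $P$ is a subgraph $G^*\subseteq G$, with the weights inherited from $G$, such that $\mathrm{dist}_{G^*}(u,v)\le(1+\epsilon)\,\mathrm{dist}_G(u,v)$ for every $(u,v)\in P$. For every fixed $\epsilon\in(0,1)$ there is a function $g:\mathbb N\to\mathbb R$ with $g(n)\to 0$ as $n\to\infty$ such that, for every $n$, every $n$-vertex undirected graph $G=(V,E)$ with nonnegative real edge weights, and every set $P\subseteq V\times V$ of $p$ pairs, there is a $(1+\epsilon)$-preserver of $G$ for $P$ with at most $n^{g(n)}\cdot(n+p)$ edges. (That is, $n^{o(1)}\cdot(n+p)$ edges, where the $o(1)$ term depends only on $n$ and $\epsilon$, not on $G$, its weights, $P$ or $p$.) -/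

import Mathlib

open Filter Topology
open scoped NNReal ENNReal

/-- The length of a walk: the sum of the weights of its edges (with multiplicity). -/
def walkLength {V : Type*} {G : SimpleGraph V} (w : Sym2 V → ℝ≥0) {u v : V}
    (q : G.Walk u v) : ℝ≥0 :=
  (q.edges.map w).sum

/-- The weighted distance from `u` to `v` in `G`: the least length of a walk from `u` to `v`,
and `∞` if there is none. Only the weights of edges of `G` matter. -/
noncomputable def weightedDist {V : Type*} (G : SimpleGraph V) (w : Sym2 V → ℝ≥0)
    (u v : V) : ℝ≥0∞ :=
  ⨅ q : G.Walk u v, (walkLength w q : ℝ≥0∞)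

/-- `H` is a `(1 + ε)`-preserver of the weighted graph `(G, w)` for the set `P` of demand pairs:
a subgraph of `G` (with inherited weights) in which the distance of every demand pair is at most
`1 + ε` times the distance in `G`. -/
def IsPreserver {V : Type*} (G : SimpleGraph V) (w : Sym2 V → ℝ≥0) (P : Finset (V × V))
    (ε : ℝ) (H : SimpleGraph V) : Prop :=
  H ≤ G ∧ ∀ u v : V, (u, v) ∈ P →
    weightedDist H w u v ≤ ENNReal.ofReal (1 + ε) * weightedDist G w u v

/-! Take nested samples V = A_0 ⊇ A_1 ⊇ ⋯ ⊇ A_{k+1} = ∅ such that every vertex v has at most s ≈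
n^(1/k) log n elements of A_i closer to it than A_{i+1}. For a ∈ A_i, the cluster of vertices closer
to a than to A_{i+1} is closed under shortest paths to a, so it has a shortest-path tree with no
more edges than vertices. These trees, with forests leading to the nearest points of A_{i+1}, cost
at most (k+1)·n·(s+1) edges (`exists_level`).

The resulting edge set behaves like a hopset (`augReach_level`): with a number of extra edges that
depends only on k and ε, a pair x, y at distance D is joined with stretch 1 + 8iδ, or x reaches
A_{i+1} within 2D. To go up a level, cut a shortest path into pieces of length at most δD and apply
the previous level to each. If some pieces fail, the first failures seen from x and from y lie close
to points z, z' of the next sample. Either the tree of z' joins z to z', giving a detour of extra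
length at most 8δD, or z has a nearby point one sample higher. At i = k the second outcome is
impossible, since A_{k+1} is empty.

For fixed k the overhead is eventually at most n^(2/k); letting k grow slowly with n makes the
exponent tend to 0. -/

/-! ### Weighted distances and shortest-path forests -/

section Distance

variable {V : Type*} {G : SimpleGraph V} {w : Sym2 V → ℝ≥0}

theorem walkLength_cons {u v x : V} (h : G.Adj u v) (q : G.Walk v x) :
    walkLength w (q.cons h) = w s(u, v) + walkLength w q := by
  simp [walkLength]

theorem weightedDist_le_walkLength {u v : V} (q : G.Walk u v) :
    weightedDist G w u v ≤ walkLength w q :=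
  iInf_le _ q

theorem weightedDist_self (u : V) : weightedDist G w u u = 0 := by
  have h := weightedDist_le_walkLength (w := w) (SimpleGraph.Walk.nil : G.Walk u u)
  simpa [walkLength] using h

theorem weightedDist_comm (u v : V) : weightedDist G w u v = weightedDist G w v u := by
  have key : ∀ a b : V, weightedDist G w a b ≤ weightedDist G w b a := fun a b =>
    le_iInf fun q => (weightedDist_le_walkLength q.reverse).trans_eq (by simp [walkLength])
  exact le_antisymm (key u v) (key v u)

theorem weightedDist_triangle (u v x : V) :
    weightedDist G w u x ≤ weightedDist G w u v + weightedDist G w v x := by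
  refine ENNReal.le_iInf_add_iInf fun p q => ?_
  refine (weightedDist_le_walkLength (p.append q)).trans_eq ?_
  simp [walkLength]

theorem weightedDist_le_of_adj {u v : V} (h : G.Adj u v) : weightedDist G w u v ≤ w s(u, v) := by
  simpa [walkLength] using weightedDist_le_walkLength (w := w) h.toWalk

theorem weightedDist_anti {G' : SimpleGraph V} (h : G ≤ G') (u v : V) :
    weightedDist G' w u v ≤ weightedDist G w u v :=
  le_iInf fun q => (weightedDist_le_walkLength (q.mapLe h)).trans_eq (by
    simp [walkLength, SimpleGraph.Walk.mapLe])

/-- Distances are attained: only the finitely many paths matter. -/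
theorem exists_walkLength_eq_weightedDist [Finite V] {u v : V} (h : weightedDist G w u v ≠ ⊤) :
    ∃ q : G.Walk u v, (walkLength w q : ℝ≥0∞) = weightedDist G w u v := by
  classical
  have := Fintype.ofFinite V
  obtain ⟨q₀⟩ : Nonempty (G.Walk u v) := by
    by_contra hn
    rw [not_nonempty_iff] at hn
    exact h (iInf_of_empty _)
  let T := {p : G.Walk u v // p.IsPath ∧ p.length < Fintype.card V}
  have : Nonempty T := ⟨⟨q₀.bypass, q₀.bypass_isPath, q₀.bypass_isPath.length_lt⟩⟩
  obtain ⟨q, hq⟩ := Finite.exists_min fun p : T => walkLength w p.1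
  refine ⟨q.1, le_antisymm (le_iInf fun p => ?_) (weightedDist_le_walkLength _)⟩
  have h1 := hq ⟨p.bypass, p.bypass_isPath, p.bypass_isPath.length_lt⟩
  have h2 : walkLength w p.bypass ≤ walkLength w p :=
    (p.edges_bypass_sublist_edges.map w).sum_le_sum fun _ _ => zero_le
  exact_mod_cast h1.trans h2

/-- The distance from a vertex to a set of vertices. -/
noncomputable def setDist (G : SimpleGraph V) (w : Sym2 V → ℝ≥0) (v : V) (A : Finset V) : ℝ≥0∞ :=
  ⨅ a ∈ A, weightedDist G w v a

theorem setDist_le {v a : V} {A : Finset V} (ha : a ∈ A) :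
    setDist G w v A ≤ weightedDist G w v a :=
  iInf₂_le a ha

theorem setDist_singleton (v a : V) : setDist G w v {a} = weightedDist G w v a := by
  simp [setDist]

theorem setDist_le_add (u v : V) (A : Finset V) :
    setDist G w u A ≤ weightedDist G w u v + setDist G w v A := by
  simp only [setDist, ENNReal.add_iInf]
  exact le_iInf₂ fun a ha => (iInf₂_le a ha).trans (weightedDist_triangle u v a)

theorem exists_weightedDist_eq_setDist {v : V} {A : Finset V} (h : setDist G w v A ≠ ⊤) :
    ∃ a ∈ A, weightedDist G w v a = setDist G w v A := by
  have hne : A.Nonempty := by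
    by_contra hn
    rw [Finset.not_nonempty_iff_eq_empty] at hn
    subst hn
    simp [setDist] at h
  obtain ⟨a, ha, hmin⟩ := A.exists_min_image (weightedDist G w v) hne
  exact ⟨a, ha, le_antisymm (le_iInf₂ hmin) (setDist_le ha)⟩

/-- A set `S` that contains every shortest path from `S` to `A` needs at most `#S` edges to
realise all distances to `A`. -/
theorem exists_forest [Finite V] (G : SimpleGraph V) (w : Sym2 V → ℝ≥0) (A S : Finset V)
    (hfin : ∀ v ∈ S, setDist G w v A ≠ ⊤)
    (hclosed : ∀ v ∈ S, ∀ x, weightedDist G w v x + setDist G w x A ≤ setDist G w v A → x ∈ S) :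
    ∃ E : Finset (Sym2 V), (E : Set (Sym2 V)) ⊆ G.edgeSet ∧ E.card ≤ S.card ∧
      ∀ v ∈ S, ∃ a ∈ A,
        weightedDist (SimpleGraph.fromEdgeSet (E : Set (Sym2 V))) w v a ≤ setDist G w v A := by
  classical
  -- Edges of weight zero need not decrease the distance to `A`, so the induction runs on the number
  -- of edges of a shortest walk instead.
  let good : V → ℕ → Prop := fun v n =>
    ∃ a ∈ A, ∃ q : G.Walk v a, (walkLength w q : ℝ≥0∞) = setDist G w v A ∧ q.length = n
  have hgood : ∀ v ∈ S, ∃ n, good v n := by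
    intro v hv
    obtain ⟨a, ha, h⟩ := exists_weightedDist_eq_setDist (hfin v hv)
    obtain ⟨q, hq⟩ := exists_walkLength_eq_weightedDist (h ▸ hfin v hv)
    exact ⟨q.length, a, ha, q, hq.trans h, rfl⟩
  -- Each vertex contributes one edge: the first edge of a shortest walk to `A` with fewest edges.
  -- It contributes `none` when that walk is empty.
  have hstep : ∀ v, ∃ e : Option (Sym2 V), v ∈ S → v ∈ A ∨ ∃ x, G.Adj v x ∧ e = some s(v, x) ∧
      x ∈ S ∧ (w s(v, x) : ℝ≥0∞) + setDist G w x A ≤ setDist G w v A ∧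
      ∀ n, good v n → (∀ k < n, ¬ good v k) → ∃ k < n, good x k := by
    intro v
    by_cases hv : v ∈ S
    swap
    · exact ⟨none, fun h => absurd h hv⟩
    obtain ⟨a, ha, q, hq, hl⟩ := Nat.find_spec (hgood v hv)
    cases q with
    | nil => exact ⟨none, fun _ => Or.inl ha⟩
    | @cons _ x _ h q' =>
      rw [walkLength_cons, ENNReal.coe_add] at hq
      have h1 : setDist G w x A ≤ walkLength w q' :=
        (setDist_le ha).trans (weightedDist_le_walkLength q')
      have h2 : (walkLength w q' : ℝ≥0∞) ≤ setDist G w x A := by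
        have : (w s(v, x) : ℝ≥0∞) + walkLength w q' ≤ w s(v, x) + setDist G w x A := by
          rw [hq]
          exact (setDist_le_add v x A).trans (by gcongr; exact weightedDist_le_of_adj h)
        exact (ENNReal.add_le_add_iff_left ENNReal.coe_ne_top).1 this
      have h3 : (w s(v, x) : ℝ≥0∞) + setDist G w x A ≤ setDist G w v A := by
        rw [← hq]; gcongr
      refine ⟨some s(v, x), fun _ => Or.inr ⟨x, h, rfl, hclosed v hv x ?_, h3, ?_⟩⟩
      · refine le_trans ?_ h3
        gcongr
        exact weightedDist_le_of_adj h
      · intro n hn hmin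
        refine ⟨q'.length, ?_, a, ha, q', le_antisymm h2 h1, rfl⟩
        have h4 := Nat.find_min' (hgood v hv) hn
        rw [← hl] at h4
        simpa using h4
  choose e he using hstep
  let E : Finset (Sym2 V) := (S.image e).eraseNone.filter (· ∈ G.edgeSet)
  refine ⟨E, fun x hx => (Finset.mem_filter.1 hx).2, ?_, ?_⟩
  · refine (Finset.card_filter_le _ _).trans ?_
    refine le_trans ?_ (Finset.card_image_le (s := S) (f := e))
    exact Finset.card_eraseNone_le _
  · have main : ∀ n, ∀ v ∈ S, good v n → ∃ a ∈ A,
        weightedDist (SimpleGraph.fromEdgeSet (E : Set (Sym2 V))) w v a ≤ setDist G w v A := by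
      intro n
      induction n using Nat.strong_induction_on with
      | _ n ih =>
        intro v hv hn
        by_cases hmin : ∀ k < n, ¬ good v k
        swap
        · push Not at hmin
          obtain ⟨k, hk, hgk⟩ := hmin
          exact ih k hk v hv hgk
        rcases he v hv with hA | ⟨x, hadj, hex, hxS, hle, hdesc⟩
        · exact ⟨v, hA, by simp [weightedDist_self]⟩
        · obtain ⟨k, hk, hgk⟩ := hdesc n hn hmin
          obtain ⟨a, ha, hxa⟩ := ih k hk x hxS hgk
          refine ⟨a, ha, (weightedDist_triangle v x a).trans (le_trans ?_ hle)⟩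
          gcongr
          apply weightedDist_le_of_adj
          rw [SimpleGraph.fromEdgeSet_adj]
          refine ⟨?_, hadj.ne⟩
          simp only [E, Finset.coe_filter, Set.mem_ofPred_eq, Finset.mem_eraseNone,
            Finset.mem_image]
          exact ⟨⟨v, hv, hex⟩, hadj⟩
    intro v hv
    obtain ⟨n, hn⟩ := hgood v hv
    exact main n v hv hn

end Distance

/-! ### Greedy hitting sets and sampling -/

section Sampling

/-- The greedy bound for hitting sets: `n` subsets of `A`, each of size at least `s`, have a
hitting set of size at most `#A / s` times the `n`-th harmonic number. -/
theorem exists_hittingSet {V ι : Type*} (A : Finset V) (s : ℕ) (hs : 0 < s) (B : ι → Finset V)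
    (I : Finset ι) (hB : ∀ i ∈ I, B i ⊆ A) (hcard : ∀ i ∈ I, s ≤ (B i).card) :
    ∃ T ⊆ A, (T.card * s : ℚ) ≤ A.card * harmonic I.card ∧ ∀ i ∈ I, ∃ x ∈ T, x ∈ B i := by
  classical
  induction hn : I.card using Nat.strong_induction_on generalizing I with
  | _ n ih =>
    rcases Nat.eq_zero_or_pos n with rfl | hpos
    · rw [Finset.card_eq_zero] at hn
      subst hn
      exact ⟨∅, by simp, by simp, by simp⟩
    have hsum : I.card * s ≤ ∑ x ∈ A, (I.filter fun i => x ∈ B i).card := by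
      calc I.card * s ≤ ∑ i ∈ I, (B i).card := by
            simpa using Finset.card_nsmul_le_sum I _ s hcard
        _ = ∑ i ∈ I, ∑ x ∈ A, if x ∈ B i then 1 else 0 := by
            refine Finset.sum_congr rfl fun i hi => ?_
            rw [← Finset.card_filter]
            congr 1
            ext x
            simp only [Finset.mem_filter]
            exact ⟨fun h => ⟨hB i hi h, h⟩, fun h => h.2⟩
        _ = _ := by
            rw [Finset.sum_comm]
            simp only [Finset.card_filter]
    -- By averaging, some `x` hits at least a fraction `s / #A` of the remaining sets.
    obtain ⟨x, hxA, hx⟩ : ∃ x ∈ A, I.card * s ≤ A.card * (I.filter fun i => x ∈ B i).card := by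
      by_contra! hcon
      have hne : A.Nonempty := by
        obtain ⟨i, hi⟩ := Finset.card_pos.1 (hn ▸ hpos)
        obtain ⟨y, hy⟩ := Finset.card_pos.1 (hs.trans_le (hcard i hi))
        exact ⟨y, hB i hi hy⟩
      have h1 := Finset.sum_lt_sum_of_nonempty hne hcon
      rw [← Finset.mul_sum, Finset.sum_const, smul_eq_mul] at h1
      exact absurd (Nat.mul_le_mul_left A.card hsum) (not_le.2 h1)
    set r := (I.filter fun i => x ∈ B i).card with hr
    have hr0 : 0 < r := by
      rcases Nat.eq_zero_or_pos r with h0 | h0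
      · rw [h0, mul_zero, hn] at hx
        exact absurd hx (not_le.2 (Nat.mul_pos hpos hs))
      · exact h0
    have hcardJ : (I.filter fun i => ¬ x ∈ B i).card + r = n := by
      rw [add_comm, hr, Finset.card_filter_add_card_filter_not, hn]
    obtain ⟨T, hTA, hTc, hT⟩ := ih _ (by omega) (I.filter fun i => ¬ x ∈ B i)
      (fun i hi => hB i (Finset.mem_filter.1 hi).1)
      (fun i hi => hcard i (Finset.mem_filter.1 hi).1) rfl
    set m := (I.filter fun i => ¬ x ∈ B i).card with hm
    refine ⟨insert x T, Finset.insert_subset hxA hTA, ?_, ?_⟩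
    -- The one new element is paid for by the drop in the harmonic number: its `r` lost terms are
    -- each at least `1 / n`.
    · have hharm : (r : ℚ) / n ≤ harmonic n - harmonic m := by
        have h1 : harmonic n - harmonic m = ∑ i ∈ Finset.Ico m n, ((i + 1 : ℕ) : ℚ)⁻¹ := by
          rw [Finset.sum_Ico_eq_sub _ (by omega)]
          rfl
        rw [h1]
        have h2 : ∀ i ∈ Finset.Ico m n, (n : ℚ)⁻¹ ≤ ((i + 1 : ℕ) : ℚ)⁻¹ := by
          intro i hi
          have := (Finset.mem_Ico.1 hi).2
          apply inv_anti₀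
          · positivity
          · exact_mod_cast this
        have h3 := Finset.card_nsmul_le_sum _ _ _ h2
        rw [Nat.card_Ico, show n - m = r by omega, nsmul_eq_mul] at h3
        exact h3
      have hn0 : (0 : ℚ) < n := by exact_mod_cast hpos
      have hsA : (s : ℚ) ≤ A.card * (r / n) := by
        rw [← mul_div_assoc, le_div_iff₀ hn0]
        rw [hn, mul_comm] at hx
        exact_mod_cast hx
      have hc : ((insert x T).card : ℚ) ≤ T.card + 1 := by
        exact_mod_cast Finset.card_insert_le x T
      calc ((insert x T).card * s : ℚ) ≤ (T.card + 1) * s := by gcongr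
        _ = T.card * s + s := by ring
        _ ≤ A.card * harmonic m + A.card * (harmonic n - harmonic m) := by
            gcongr
            exact hsA.trans (by gcongr)
        _ = A.card * harmonic n := by ring
    · intro i hi
      by_cases hxi : x ∈ B i
      · exact ⟨x, Finset.mem_insert_self x T, hxi⟩
      · obtain ⟨y, hy, hyB⟩ := hT i (Finset.mem_filter.2 ⟨hi, hxi⟩)
        exact ⟨y, Finset.mem_insert_of_mem hy, hyB⟩

/-- Among the elements of a finite set there are `s` smallest ones for a given function. -/
theorem exists_smallest {α β : Type*} [LinearOrder β] (f : α → β) (A : Finset α) (s : ℕ)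
    (hs : s ≤ A.card) :
    ∃ B ⊆ A, B.card = s ∧ ∀ x ∈ B, ∀ y ∈ A, y ∉ B → f x ≤ f y := by
  classical
  induction s with
  | zero => exact ⟨∅, by simp, by simp, by simp⟩
  | succ s ih =>
    obtain ⟨B, hBA, hBs, hB⟩ := ih (by omega)
    have hne : (A \ B).Nonempty := by
      rw [← Finset.card_pos, Finset.card_sdiff_of_subset hBA]
      omega
    obtain ⟨z, hz, hmin⟩ := (A \ B).exists_min_image f hne
    rw [Finset.mem_sdiff] at hz
    refine ⟨insert z B, Finset.insert_subset hz.1 hBA, ?_, ?_⟩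
    · rw [Finset.card_insert_of_notMem hz.2, hBs]
    · intro x hx y hy hyB
      rw [Finset.mem_insert, not_or] at hyB
      rcases Finset.mem_insert.1 hx with rfl | hx
      · exact hmin y (Finset.mem_sdiff.2 ⟨hy, hyB.2⟩)
      · exact hB x hx y hy hyB.2

open Classical in
/-- A subset `A'` of `A`, smaller by a factor of about `s`, such that every vertex has at most `s`
elements of `A` that are closer to it than `A'`. -/
theorem exists_sample {V : Type*} [Fintype V] (G : SimpleGraph V) (w : Sym2 V → ℝ≥0)
    (A : Finset V) (s : ℕ) (hs : 0 < s) :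
    ∃ A' ⊆ A, (A'.card * s : ℚ) ≤ A.card * harmonic (Fintype.card V) ∧
      ∀ v, (A.filter fun a => weightedDist G w v a < setDist G w v A').card ≤ s := by
  rcases le_or_gt s A.card with hsA | hsA
  -- `B v` holds `s` elements of `A` nearest to `v`; since `T` meets it, anything closer to `v` than
  -- `T` lies in `B v`.
  · choose B hBA hBs hB using fun v => exists_smallest (weightedDist G w v) A s hsA
    obtain ⟨T, hTA, hTc, hT⟩ := exists_hittingSet A s hs B Finset.univ (fun v _ => hBA v)
      (fun v _ => (hBs v).ge)
    refine ⟨T, hTA, hTc, fun v => ?_⟩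
    rw [← hBs v]
    refine Finset.card_le_card fun a ha => ?_
    rw [Finset.mem_filter] at ha
    by_contra hna
    obtain ⟨x, hxT, hxB⟩ := hT v (Finset.mem_univ v)
    exact absurd ((setDist_le hxT).trans (hB v x hxB a ha.1 hna)) (not_le.2 ha.2)
  -- The distance to the empty set is `⊤`, so the count is at most `#A < s`.
  · refine ⟨∅, by simp, ?_, fun v => (Finset.card_filter_le _ _).trans hsA.le⟩
    have : 0 ≤ harmonic (Fintype.card V) := by
      unfold harmonic
      positivity
    simp only [Finset.card_empty, Nat.cast_zero, zero_mul]
    positivity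

end Sampling

/-! ### Clusters and pivots of one level -/

open Classical in
/-- One level of the Thorup–Zwick construction: few edges realise the distances from every vertex
to the elements of `A` closer than `A'`, and to `A'` itself. -/
theorem exists_level {V : Type*} [Fintype V] (G : SimpleGraph V) (w : Sym2 V → ℝ≥0)
    (A A' : Finset V) (s : ℕ)
    (hA : ∀ v, (A.filter fun a => weightedDist G w v a < setDist G w v A').card ≤ s) :
    ∃ E : Finset (Sym2 V), (E : Set (Sym2 V)) ⊆ G.edgeSet ∧
      E.card ≤ Fintype.card V * (s + 1) ∧
      (∀ v, ∀ a ∈ A, weightedDist G w v a < setDist G w v A' →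
        weightedDist (SimpleGraph.fromEdgeSet (E : Set (Sym2 V))) w v a ≤ weightedDist G w v a) ∧
      (∀ v, setDist G w v A' ≠ ⊤ → ∃ z ∈ A',
        weightedDist (SimpleGraph.fromEdgeSet (E : Set (Sym2 V))) w v z ≤ setDist G w v A') := by
  obtain ⟨E₀, hE₀, hc₀, hd₀⟩ := exists_forest G w A'
    (Finset.univ.filter fun v => setDist G w v A' ≠ ⊤) (by simp) (by
      intro v hv x hx
      simp only [Finset.mem_filter, Finset.mem_univ, true_and] at hv ⊢
      exact ne_top_of_le_ne_top hv (le_add_self.trans hx))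
  have hcl : ∀ a, ∃ E : Finset (Sym2 V), (E : Set (Sym2 V)) ⊆ G.edgeSet ∧
      E.card ≤ (Finset.univ.filter fun v => weightedDist G w v a < setDist G w v A').card ∧
      ∀ v, weightedDist G w v a < setDist G w v A' →
        weightedDist (SimpleGraph.fromEdgeSet (E : Set (Sym2 V))) w v a
          ≤ weightedDist G w v a := by
    intro a
    obtain ⟨E, hE, hc, hd⟩ := exists_forest G w {a}
      (Finset.univ.filter fun v => weightedDist G w v a < setDist G w v A') (by
        intro v hv
        simp only [Finset.mem_filter, Finset.mem_univ, true_and] at hv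
        rw [setDist_singleton]
        exact ne_top_of_lt hv) (by
        intro v hv x hx
        simp only [Finset.mem_filter, Finset.mem_univ, true_and, setDist_singleton] at hv hx ⊢
        -- If `x` lies on a shortest path from `v` to `a` but were no closer to `a` than to `A'`,
        -- neither would `v` be.
        have h1 := (hx.trans_lt hv).trans_le (setDist_le_add v x A')
        exact lt_of_add_lt_add_left h1)
    refine ⟨E, hE, hc, fun v hv => ?_⟩
    obtain ⟨b, hb, h⟩ := hd v (by simpa using hv)
    rw [Finset.mem_singleton] at hb
    subst hb
    rwa [setDist_singleton] at h
  choose E hE hc hd using hcl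
  refine ⟨E₀ ∪ A.biUnion E, ?_, ?_, ?_, ?_⟩
  · rw [Finset.coe_union, Finset.coe_biUnion]
    exact Set.union_subset hE₀ (Set.iUnion₂_subset fun a _ => hE a)
  · have h1 : (A.biUnion E).card ≤ Fintype.card V * s := by
      calc (A.biUnion E).card ≤ ∑ a ∈ A, (E a).card := Finset.card_biUnion_le
        _ ≤ ∑ a ∈ A, ∑ v : V, if weightedDist G w v a < setDist G w v A' then 1 else 0 := by
            gcongr with a
            rw [← Finset.card_filter]
            exact hc a
        -- Double counting: total cluster size equals the total number of near sample points.
        _ = ∑ v : V, (A.filter fun a => weightedDist G w v a < setDist G w v A').card := by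
            rw [Finset.sum_comm]
            simp only [Finset.card_filter]
        _ ≤ ∑ _v : V, s := Finset.sum_le_sum fun v _ => hA v
        _ = Fintype.card V * s := by simp
    have h2 : E₀.card ≤ Fintype.card V := hc₀.trans (Finset.card_le_univ _)
    have h3 := Finset.card_union_le E₀ (A.biUnion E)
    linarith
  · intro v a ha hv
    refine (weightedDist_anti (SimpleGraph.fromEdgeSet_mono ?_) v a).trans (hd a v hv)
    rw [Finset.coe_subset]
    exact (Finset.subset_biUnion_of_mem E ha).trans Finset.subset_union_right
  · intro v hv
    obtain ⟨z, hz, h⟩ := hd₀ v (by simpa using hv)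
    refine ⟨z, hz, (weightedDist_anti (SimpleGraph.fromEdgeSet_mono ?_) v z).trans h⟩
    rw [Finset.coe_subset]
    exact Finset.subset_union_left

/-! ### Approximate paths with few added edges -/

section Hopset

variable {V : Type*} {G : SimpleGraph V} {w : Sym2 V → ℝ≥0} {E : Finset (Sym2 V)}

/-- Adding at most `b` edges of `G` to the edge set `E` brings `y` within distance `ℓ` of `x`. -/
def AugReach (G : SimpleGraph V) (w : Sym2 V → ℝ≥0) (E : Finset (Sym2 V)) (b : ℕ) (x y : V)
    (ℓ : ℝ≥0∞) : Prop :=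
  ∃ F : Finset (Sym2 V), (F : Set (Sym2 V)) ⊆ G.edgeSet ∧ F.card ≤ b ∧
    weightedDist (SimpleGraph.fromEdgeSet ((E : Set (Sym2 V)) ∪ F)) w x y ≤ ℓ

theorem AugReach.mono {b b' : ℕ} {x y : V} {ℓ ℓ' : ℝ≥0∞} (h : AugReach G w E b x y ℓ)
    (hb : b ≤ b') (hℓ : ℓ ≤ ℓ') : AugReach G w E b' x y ℓ' := by
  obtain ⟨F, hF, hc, hd⟩ := h
  exact ⟨F, hF, hc.trans hb, hd.trans hℓ⟩

theorem AugReach.symm {b : ℕ} {x y : V} {ℓ : ℝ≥0∞} (h : AugReach G w E b x y ℓ) :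
    AugReach G w E b y x ℓ := by
  obtain ⟨F, hF, hc, hd⟩ := h
  exact ⟨F, hF, hc, (weightedDist_comm y x).trans_le hd⟩

theorem AugReach.trans {b c : ℕ} {x y z : V} {ℓ m : ℝ≥0∞} (h : AugReach G w E b x y ℓ)
    (h' : AugReach G w E c y z m) : AugReach G w E (b + c) x z (ℓ + m) := by
  classical
  obtain ⟨F, hF, hc, hd⟩ := h
  obtain ⟨F', hF', hc', hd'⟩ := h'
  refine ⟨F ∪ F', ?_, (Finset.card_union_le _ _).trans (add_le_add hc hc'), ?_⟩
  · rw [Finset.coe_union]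
    exact Set.union_subset hF hF'
  · refine (weightedDist_triangle x y z).trans (add_le_add ?_ ?_)
    · refine (weightedDist_anti (SimpleGraph.fromEdgeSet_mono ?_) x y).trans hd
      rw [Finset.coe_union]
      exact Set.union_subset_union_right _ Set.subset_union_left
    · refine (weightedDist_anti (SimpleGraph.fromEdgeSet_mono ?_) y z).trans hd'
      rw [Finset.coe_union]
      exact Set.union_subset_union_right _ Set.subset_union_right

theorem AugReach.weightedDist_le {b : ℕ} {x y : V} {ℓ : ℝ≥0∞} (h : AugReach G w E b x y ℓ)
    (hE : (E : Set (Sym2 V)) ⊆ G.edgeSet) : weightedDist G w x y ≤ ℓ := by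
  obtain ⟨F, hF, -, hd⟩ := h
  refine (weightedDist_anti ?_ x y).trans hd
  exact (SimpleGraph.fromEdgeSet_mono (Set.union_subset hE hF)).trans_eq
    (SimpleGraph.fromEdgeSet_edgeSet G)

theorem augReach_of_weightedDist_le {x y : V} {ℓ : ℝ≥0∞}
    (h : weightedDist (SimpleGraph.fromEdgeSet (E : Set (Sym2 V))) w x y ≤ ℓ) :
    AugReach G w E 0 x y ℓ :=
  ⟨∅, by simp, by simp, by simpa using h⟩

theorem augReach_top (b : ℕ) (x y : V) : AugReach G w E b x y ⊤ :=
  ⟨∅, by simp, by simp, le_top⟩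

theorem augReach_of_adj {x y : V} (h : G.Adj x y) : AugReach G w E 1 x y (w s(x, y)) := by
  refine ⟨{s(x, y)}, by simpa using h, by simp, weightedDist_le_of_adj ?_⟩
  rw [SimpleGraph.fromEdgeSet_adj]
  exact ⟨by simp, h.ne⟩

/-- A shortest walk longer than `t` has an edge that crosses distance `t` from its start. -/
theorem exists_crossing_edge {x a y : V} {t : ℝ≥0∞} (q : G.Walk a y)
    (ha : weightedDist G w x a ≤ t)
    (hq : weightedDist G w x a + walkLength w q ≤ weightedDist G w x y)
    (ht : t < weightedDist G w x y) :
    ∃ v v', G.Adj v v' ∧ weightedDist G w x v ≤ t ∧ t < weightedDist G w x v' ∧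
      weightedDist G w x v + w s(v, v') + weightedDist G w v' y ≤ weightedDist G w x y := by
  induction q with
  | nil => exact absurd ha (not_le.2 ht)
  | @cons a a' y h q ih =>
    rw [walkLength_cons, ENNReal.coe_add, ← add_assoc] at hq
    rcases le_or_gt (weightedDist G w x a') t with h1 | h1
    · refine ih h1 (le_trans ?_ hq) ht
      gcongr
      exact (weightedDist_triangle x a a').trans (by gcongr; exact weightedDist_le_of_adj h)
    · refine ⟨a, a', h, ha, h1, le_trans ?_ hq⟩
      gcongr
      exact weightedDist_le_walkLength q

/-- Cut a shortest path into pieces of length at most `t`: either all pieces are approximated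
well, or there is a first piece that starts at a `Bad` vertex. -/
theorem augReach_or_exists_bad [Finite V] {c t : ℝ≥0∞} {b : ℕ} {Bad : V → Prop} (hc : 1 ≤ c)
    (hseg : ∀ u v, weightedDist G w u v ≤ t →
      AugReach G w E b u v (c * weightedDist G w u v) ∨ Bad u)
    (m : ℕ) (x y : V) (hxy : weightedDist G w x y ≤ m * t) (hfin : weightedDist G w x y ≠ ⊤) :
    AugReach G w E ((m + 1) * (b + 1)) x y (c * weightedDist G w x y) ∨
      ∃ u, weightedDist G w x u + weightedDist G w u y ≤ weightedDist G w x y ∧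
        AugReach G w E ((m + 1) * (b + 1)) x u (c * weightedDist G w x u) ∧ Bad u := by
  induction m generalizing x with
  | zero =>
    rw [Nat.cast_zero, zero_mul] at hxy
    rcases hseg x y (hxy.trans zero_le) with h | h
    · exact Or.inl (h.mono (by omega) le_rfl)
    · refine Or.inr ⟨x, by simp [weightedDist_self], ?_, h⟩
      exact (augReach_of_weightedDist_le (by simp [weightedDist_self])).mono (Nat.zero_le _) le_rfl
  | succ m ih =>
    have hself : Bad x → ∃ u, weightedDist G w x u + weightedDist G w u y ≤ weightedDist G w x y ∧
        AugReach G w E ((m + 1 + 1) * (b + 1)) x u (c * weightedDist G w x u) ∧ Bad u := by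
      intro h
      refine ⟨x, by simp [weightedDist_self], ?_, h⟩
      exact (augReach_of_weightedDist_le (by simp [weightedDist_self])).mono (Nat.zero_le _) le_rfl
    rcases le_or_gt (weightedDist G w x y) t with h1 | h1
    · rcases hseg x y h1 with h | h
      · exact Or.inl (h.mono (by nlinarith) le_rfl)
      · exact Or.inr (hself h)
    · obtain ⟨q, hq⟩ := exists_walkLength_eq_weightedDist hfin
      obtain ⟨v, v', hadj, hv, hv', hle⟩ := exists_crossing_edge (w := w) (x := x) (t := t) q
        (by simp [weightedDist_self]) (by simp [weightedDist_self, hq]) h1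
      rcases hseg x v hv with h | h
      swap
      · exact Or.inr (hself h)
      -- The crossing edge may be much longer than `t`, so it is added itself, without stretch. Past
      -- it, at least `t` of the distance has been used up.
      have hxv' : AugReach G w E (b + 1) x v'
          (c * (weightedDist G w x v + w s(v, v'))) := by
        refine (h.trans (augReach_of_adj hadj)).mono le_rfl ?_
        rw [mul_add]
        gcongr
        exact le_mul_of_one_le_left zero_le hc
      have hx' : weightedDist G w x v' ≤ weightedDist G w x v + w s(v, v') :=
        (weightedDist_triangle x v v').trans (by gcongr; exact weightedDist_le_of_adj hadj)
      have hfin' : weightedDist G w v' y ≠ ⊤ :=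
        ne_top_of_le_ne_top hfin (le_add_self.trans hle)
      have hfinv : weightedDist G w x v + w s(v, v') ≠ ⊤ :=
        ne_top_of_le_ne_top hfin (le_self_add.trans hle)
      have hshort : weightedDist G w v' y ≤ m * t := by
        have h2 : t + weightedDist G w v' y ≤ t + m * t := by
          calc t + weightedDist G w v' y ≤ weightedDist G w x v + w s(v, v')
                + weightedDist G w v' y := by gcongr; exact hv'.le.trans hx'
            _ ≤ weightedDist G w x y := hle
            _ ≤ _ := hxy
            _ = t + m * t := by push_cast; ring
        exact (ENNReal.add_le_add_iff_left (ne_top_of_lt h1)).1 h2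
      rcases ih v' hshort hfin' with h3 | ⟨u, hu, hru, hbad⟩
      · refine Or.inl ((hxv'.trans h3).mono (by linarith [add_mul (m + 1) 1 (b + 1)]) ?_)
        rw [← mul_add]
        gcongr
      · have hxu : weightedDist G w x v + w s(v, v') + weightedDist G w v' u
            ≤ weightedDist G w x u := by
          have h4 : weightedDist G w x v + w s(v, v') + weightedDist G w v' u
              + weightedDist G w u y ≤ weightedDist G w x u + weightedDist G w u y := by
            calc _ ≤ weightedDist G w x v + w s(v, v') + weightedDist G w v' y := by
                  rw [add_assoc (weightedDist G w x v + w s(v, v'))]; gcongr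
              _ ≤ weightedDist G w x y := hle
              _ ≤ _ := weightedDist_triangle x u y
          exact (ENNReal.add_le_add_iff_right
            (ne_top_of_le_ne_top hfin' (le_add_self.trans hu))).1 h4
        refine Or.inr ⟨u, ?_, (hxv'.trans hru).mono (by linarith [add_mul (m + 1) 1 (b + 1)]) ?_,
          hbad⟩
        · calc weightedDist G w x u + weightedDist G w u y
              ≤ weightedDist G w x v + w s(v, v') + weightedDist G w v' u
                + weightedDist G w u y := by
                gcongr
                exact (weightedDist_triangle x v' u).trans (by gcongr)
            _ ≤ weightedDist G w x v + w s(v, v') + weightedDist G w v' y := by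
                rw [add_assoc (weightedDist G w x v + w s(v, v'))]; gcongr
            _ ≤ _ := hle
        · rw [← mul_add]
          gcongr

/-- The number of edges a demand pair adds after `i` levels, when paths are cut into `m` pieces. -/
def hopBudget (m : ℕ) : ℕ → ℕ
  | 0 => 0
  | i + 1 => 2 * ((m + 1) * (hopBudget m i + 1) + hopBudget m i)

/-- The hypothesis `hm` makes `m` steps of length `δ D` cover a path of length `D`. The hypothesis
`hδ` keeps the accumulated stretch small enough that the factor 2 in the second outcome survives
every level. -/
theorem augReach_level [Finite V] {A : ℕ → Finset V} {k m : ℕ} {δ : ℝ≥0} (hE : (E : Set (Sym2 V)) ⊆ G.edgeSet)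
    (hA0 : ∀ v, v ∈ A 0)
    (hbunch : ∀ i ≤ k, ∀ v, ∀ a ∈ A i, weightedDist G w v a < setDist G w v (A (i + 1)) →
      weightedDist (SimpleGraph.fromEdgeSet (E : Set (Sym2 V))) w v a ≤ weightedDist G w v a)
    (hpivot : ∀ i ≤ k, ∀ v, setDist G w v (A (i + 1)) ≠ ⊤ → ∃ z ∈ A (i + 1),
      weightedDist (SimpleGraph.fromEdgeSet (E : Set (Sym2 V))) w v z
        ≤ setDist G w v (A (i + 1)))
    (hm : 1 ≤ m * δ) (hδ : 8 * (k + 1) * δ ≤ 1) (i : ℕ) (hi : i ≤ k) (x y : V) :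
    AugReach G w E (hopBudget m i) x y ((1 + 8 * i * δ : ℝ≥0) * weightedDist G w x y) ∨
      ∃ z ∈ A (i + 1), AugReach G w E (hopBudget m i) x z (2 * weightedDist G w x y) := by
  -- Without extra edges: a target in `A i` is either near enough to have its own tree through `x`,
  -- or no nearer than a point of `A (i + 1)`.
  have base : ∀ i ≤ k, ∀ x, ∀ y ∈ A i, weightedDist G w x y ≠ ⊤ →
      AugReach G w E 0 x y (weightedDist G w x y) ∨
        ∃ z ∈ A (i + 1), AugReach G w E 0 x z (weightedDist G w x y) := by
    intro i hi x y hy hfin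
    rcases lt_or_ge (weightedDist G w x y) (setDist G w x (A (i + 1))) with h | h
    · exact Or.inl (augReach_of_weightedDist_le (hbunch i hi x y hy h))
    · obtain ⟨z, hz, hd⟩ := hpivot i hi x (ne_top_of_le_ne_top hfin h)
      exact Or.inr ⟨z, hz, augReach_of_weightedDist_le (hd.trans h)⟩
  induction i generalizing x y with
  | zero =>
    by_cases hfin : weightedDist G w x y = ⊤
    · refine Or.inl ((augReach_top _ _ _).mono le_rfl ?_)
      simp [hfin]
    rcases base 0 hi x y (hA0 y) hfin with h | ⟨z, hz, h⟩
    · exact Or.inl (h.mono le_rfl (by simp))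
    · exact Or.inr ⟨z, hz, h.mono le_rfl (le_mul_of_one_le_left zero_le one_le_two)⟩
  | succ i ih =>
    specialize ih (by omega)
    by_cases hfin : weightedDist G w x y = ⊤
    · refine Or.inl ((augReach_top _ _ _).mono le_rfl ?_)
      rw [hfin, ENNReal.mul_top]
      simp
    set D := weightedDist G w x y with hD
    set b := hopBudget m i with hb
    set c : ℝ≥0∞ := ((1 + 8 * i * δ : ℝ≥0) : ℝ≥0∞) with hc
    set t : ℝ≥0∞ := δ * D with ht
    have hc1 : 1 ≤ c := by
      rw [hc]
      exact_mod_cast le_self_add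
    have hcs : ((1 + 8 * (i + 1 : ℕ) * δ : ℝ≥0) : ℝ≥0∞) * D = c * D + 8 * t := by
      rw [hc, ht]
      push_cast
      ring
    have hc2 : c * D + 6 * t ≤ 2 * D := by
      have h1 : (1 + 8 * i * δ + 6 * δ : ℝ≥0) ≤ 2 := by
        have h2 : (i + 1 : ℝ≥0) ≤ k := by exact_mod_cast hi
        have h3 : 8 * (i : ℝ≥0) * δ + 6 * δ ≤ 8 * (k + 1) * δ := by
          calc 8 * (i : ℝ≥0) * δ + 6 * δ ≤ 8 * i * δ + 8 * δ := by gcongr; norm_num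
            _ = 8 * (i + 1) * δ := by ring
            _ ≤ 8 * (k + 1) * δ := by gcongr; exact Nat.le_of_succ_le hi
        calc (1 + 8 * i * δ + 6 * δ : ℝ≥0) = 1 + (8 * i * δ + 6 * δ) := by ring
          _ ≤ 1 + 1 := by gcongr; exact h3.trans hδ
          _ = 2 := by norm_num
      have h4 : c * D + 6 * t = ((1 + 8 * i * δ + 6 * δ : ℝ≥0) : ℝ≥0∞) * D := by
        rw [hc, ht]
        push_cast
        ring
      rw [h4]
      gcongr
      exact_mod_cast h1
    have hmt : D ≤ m * t := by
      have : (1 : ℝ≥0∞) ≤ m * δ := by exact_mod_cast hm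
      calc D = 1 * D := (one_mul D).symm
        _ ≤ m * δ * D := by gcongr
        _ = m * t := by rw [ht, mul_assoc]
    let Bad : V → Prop := fun u => ∃ z ∈ A (i + 1), AugReach G w E b u z (2 * t)
    have hseg : ∀ u v, weightedDist G w u v ≤ t →
        AugReach G w E b u v (c * weightedDist G w u v) ∨ Bad u := by
      intro u v huv
      rcases ih u v with h | ⟨z, hz, h⟩
      · exact Or.inl h
      · exact Or.inr ⟨z, hz, h.mono le_rfl (by gcongr)⟩
    -- Two cut paths, from `x` and from `y`, plus a detour of `b` edges at each failure; the link
    -- between `z` and `z'` adds none.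
    have hbud : hopBudget m (i + 1) = 2 * ((m + 1) * (b + 1) + b) := rfl
    rw [hcs, hbud]
    rcases augReach_or_exists_bad hc1 hseg m x y hmt hfin with h | ⟨u, hu, hxu, z, hz, huz⟩
    · exact Or.inl (h.mono (by omega) le_self_add)
    have huD : weightedDist G w u y ≤ D := le_add_self.trans hu
    have hyu : weightedDist G w y u ≤ D := (weightedDist_comm y u).trans_le huD
    -- The search from `y` stops at `u`, so its first failure `u'` lies between `u` and `y` on a
    -- shortest path.
    rcases augReach_or_exists_bad hc1 hseg m y u (hyu.trans hmt) (ne_top_of_le_ne_top hfin hyu)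
      with h | ⟨u', hu', hyu', z', hz', huz'⟩
    · refine Or.inl ((hxu.trans h.symm).mono (by omega) ?_)
      rw [← mul_add, weightedDist_comm y u]
      exact (mul_le_mul_right hu c).trans le_self_add
    have hsum : weightedDist G w x u + weightedDist G w u u' + weightedDist G w y u' ≤ D := by
      calc _ = weightedDist G w x u + (weightedDist G w y u' + weightedDist G w u' u) := by
            rw [weightedDist_comm u u']; ring
        _ ≤ weightedDist G w x u + weightedDist G w u y := by
            rw [weightedDist_comm u y]; gcongr
        _ ≤ D := hu
    have haug : ∀ {b' : ℕ} {p q : V} {ℓ : ℝ≥0∞}, AugReach G w E b' p q ℓ →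
        weightedDist G w p q ≤ ℓ := fun h => h.weightedDist_le hE
    have hzz : weightedDist G w z z' ≤ 4 * t + weightedDist G w u u' := by
      calc weightedDist G w z z' ≤ weightedDist G w z u + weightedDist G w u z' :=
            weightedDist_triangle _ _ _
        _ ≤ weightedDist G w z u + (weightedDist G w u u' + weightedDist G w u' z') := by
            gcongr; exact weightedDist_triangle _ _ _
        _ ≤ 2 * t + (weightedDist G w u u' + 2 * t) := by
            gcongr
            · exact haug huz.symm
            · exact haug huz'
        _ = _ := by ring
    have htfin : t ≠ ⊤ := ENNReal.mul_ne_top ENNReal.coe_ne_top hfin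
    have huufin : weightedDist G w u u' ≠ ⊤ :=
      ne_top_of_le_ne_top hfin ((le_add_self.trans le_self_add).trans hsum)
    have hzfin : weightedDist G w z z' ≠ ⊤ :=
      ne_top_of_le_ne_top (ENNReal.add_ne_top.2
        ⟨ENNReal.mul_ne_top (by norm_num) htfin, huufin⟩) hzz
    rcases base (i + 1) hi z z' hz' hzfin with h | ⟨p, hp, h⟩
    -- Extra length: `2t` each for `u` to `z` and `z'` to `u'`, and `4t` for `z` to `z'` compared
    -- with `u` to `u'`.
    · refine Or.inl (((((hxu.trans huz).trans h).trans huz'.symm).trans hyu'.symm).mono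
        (by omega) ?_)
      calc _ ≤ c * weightedDist G w x u + 2 * t + (4 * t + weightedDist G w u u') + 2 * t
            + c * weightedDist G w y u' := by gcongr
        _ ≤ c * weightedDist G w x u + 2 * t + (4 * t + c * weightedDist G w u u') + 2 * t
            + c * weightedDist G w y u' := by
            gcongr; exact le_mul_of_one_le_left zero_le hc1
        _ = c * (weightedDist G w x u + weightedDist G w u u' + weightedDist G w y u')
            + 8 * t := by ring
        _ ≤ _ := by gcongr
    · refine Or.inr ⟨p, hp, ((hxu.trans huz).trans h).mono (by nlinarith) ?_⟩
      calc _ ≤ c * weightedDist G w x u + 2 * t + (4 * t + weightedDist G w u u') := by gcongr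
        _ ≤ c * weightedDist G w x u + 2 * t + (4 * t + c * weightedDist G w u u') := by
            gcongr; exact le_mul_of_one_le_left zero_le hc1
        _ = c * (weightedDist G w x u + weightedDist G w u u') + 6 * t := by ring
        _ ≤ c * D + 6 * t := by gcongr; exact le_self_add.trans hsum
        _ ≤ _ := hc2

end Hopset

/-! ### Assembling the preserver -/

/-- Samples `A 0 ⊇ A 1 ⊇ ⋯`, each smaller than the previous one by a factor of at least `r`. -/
theorem exists_samples {V : Type*} [Fintype V] (G : SimpleGraph V) (w : Sym2 V → ℝ≥0) (s : ℕ)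
    (hs : 0 < s) (r : ℝ) (hr : 0 < r) (hrs : harmonic (Fintype.card V) * r ≤ (s : ℝ)) :
    ∃ A : ℕ → Finset V, A 0 = Finset.univ ∧
      (∀ i, ((A i).card : ℝ) * r ^ i ≤ Fintype.card V) ∧
      ∀ i, ∃ E : Finset (Sym2 V), (E : Set (Sym2 V)) ⊆ G.edgeSet ∧
        E.card ≤ Fintype.card V * (s + 1) ∧
        (∀ v, ∀ a ∈ A i, weightedDist G w v a < setDist G w v (A (i + 1)) →
          weightedDist (SimpleGraph.fromEdgeSet (E : Set (Sym2 V))) w v a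
            ≤ weightedDist G w v a) ∧
        (∀ v, setDist G w v (A (i + 1)) ≠ ⊤ → ∃ z ∈ A (i + 1),
          weightedDist (SimpleGraph.fromEdgeSet (E : Set (Sym2 V))) w v z
            ≤ setDist G w v (A (i + 1))) := by
  classical
  choose f hfA hfc hf using fun A => exists_sample G w A s hs
  let A : ℕ → Finset V := fun i => f^[i] Finset.univ
  have hA : ∀ i, A (i + 1) = f (A i) := fun i => Function.iterate_succ_apply' f i _
  refine ⟨A, rfl, fun i => ?_, fun i => ?_⟩
  · induction i with
    | zero => simp [A]
    | succ i ih =>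
      have h1 : ((A (i + 1)).card * s : ℝ) ≤ (A i).card * harmonic (Fintype.card V) := by
        rw [hA]
        exact_mod_cast hfc (A i)
      have hs' : (0 : ℝ) < s := by exact_mod_cast hs
      have h2 : ((A (i + 1)).card * r : ℝ) ≤ (A i).card := by
        refine le_of_mul_le_mul_right ?_ hs'
        calc ((A (i + 1)).card * r * s : ℝ) = (A (i + 1)).card * s * r := by ring
          _ ≤ (A i).card * harmonic (Fintype.card V) * r := by gcongr
          _ = (A i).card * (harmonic (Fintype.card V) * r) := by ring
          _ ≤ (A i).card * s := by gcongr
      calc ((A (i + 1)).card * r ^ (i + 1) : ℝ) = (A (i + 1)).card * r * r ^ i := by ring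
        _ ≤ (A i).card * r ^ i := by gcongr
        _ ≤ _ := ih
  · rw [hA]
    refine exists_level G w (A i) (f (A i)) s fun v => ?_
    convert hf (A i) v

/-- The preserver with `k + 1` levels of sampling. -/
theorem exists_isPreserver {V : Type*} [Fintype V] (G : SimpleGraph V) (w : Sym2 V → ℝ≥0)
    (P : Finset (V × V)) (k m s : ℕ) (δ ε : ℝ≥0) (hm : 1 ≤ m * δ) (hδε : 8 * (k + 1) * δ ≤ ε)
    (hε : ε ≤ 1) (hs : 0 < s) (r : ℝ) (hr : 1 < r) (hrk : (Fintype.card V : ℝ) ≤ r ^ k)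
    (hrs : harmonic (Fintype.card V) * r ≤ (s : ℝ)) :
    ∃ H : SimpleGraph V, IsPreserver G w P ε H ∧
      H.edgeSet.ncard ≤
        (k + 1) * (Fintype.card V * (s + 1)) + P.card * hopBudget m k := by
  classical
  have hr0 : 0 < r := one_pos.trans hr
  obtain ⟨A, hA0, hAc, hlev⟩ := exists_samples G w s hs r hr0 hrs
  choose E hE hEc hbunch hpivot using hlev
  -- A nonempty last sample would give `r ^ (k + 1) ≤ n ≤ r ^ k`, against `r > 1`.
  have hlast : A (k + 1) = ∅ := by
    by_contra hne
    have h1 : (1 : ℝ) ≤ (A (k + 1)).card := by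
      exact_mod_cast Finset.card_pos.2 (Finset.nonempty_iff_ne_empty.2 hne)
    have h2 : r ^ k < r ^ (k + 1) := pow_lt_pow_right₀ hr (Nat.lt_succ_self k)
    have h3 : 1 * r ^ (k + 1) ≤ (A (k + 1)).card * r ^ (k + 1) := by gcongr
    linarith [hAc (k + 1)]
  let U : Finset (Sym2 V) := (Finset.range (k + 1)).biUnion E
  have hU : (U : Set (Sym2 V)) ⊆ G.edgeSet := by
    rw [Finset.coe_biUnion]
    exact Set.iUnion₂_subset fun i _ => hE i
  have hEU : ∀ i ≤ k, ∀ u v, weightedDist (SimpleGraph.fromEdgeSet (U : Set (Sym2 V))) w u v ≤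
      weightedDist (SimpleGraph.fromEdgeSet (E i : Set (Sym2 V))) w u v := by
    intro i hi u v
    refine weightedDist_anti (SimpleGraph.fromEdgeSet_mono ?_) u v
    rw [Finset.coe_subset]
    exact Finset.subset_biUnion_of_mem E (Finset.mem_range.2 (Nat.lt_succ_of_le hi))
  have hreach : ∀ x y, AugReach G w U (hopBudget m k) x y
      ((1 + ε : ℝ≥0) * weightedDist G w x y) := by
    intro x y
    rcases augReach_level (A := A) (k := k) (m := m) (δ := δ) hU (fun v => hA0 ▸ Finset.mem_univ v)
      (fun i hi v a ha h => (hEU i hi v a).trans (hbunch i v a ha h))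
      (fun i hi v h => by
        obtain ⟨z, hz, hd⟩ := hpivot i v h
        exact ⟨z, hz, (hEU i hi v z).trans hd⟩)
      hm (hδε.trans hε) k le_rfl x y with h | ⟨z, hz, -⟩
    · refine h.mono le_rfl ?_
      gcongr
      refine le_trans ?_ hδε
      gcongr
      exact le_self_add
    · rw [hlast] at hz
      exact absurd hz (Finset.notMem_empty z)
  choose F hF hFc hFd using fun p : V × V => hreach p.1 p.2
  let W : Finset (Sym2 V) := U ∪ P.biUnion F
  have hW : (W : Set (Sym2 V)) ⊆ G.edgeSet := by
    rw [Finset.coe_union, Finset.coe_biUnion (s := P)]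
    exact Set.union_subset hU (Set.iUnion₂_subset fun p _ => hF p)
  refine ⟨SimpleGraph.fromEdgeSet (W : Set (Sym2 V)), ⟨?_, fun u v huv => ?_⟩, ?_⟩
  · exact (SimpleGraph.fromEdgeSet_mono hW).trans_eq (SimpleGraph.fromEdgeSet_edgeSet G)
  · refine (weightedDist_anti (SimpleGraph.fromEdgeSet_mono ?_) u v).trans
      ((hFd (u, v)).trans_eq ?_)
    · rw [Finset.coe_union]
      refine Set.union_subset_union_right _ ?_
      rw [Finset.coe_subset]
      exact Finset.subset_biUnion_of_mem F huv
    · congr 1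
      rw [← ENNReal.ofReal_coe_nnreal]
      simp
  · calc (SimpleGraph.fromEdgeSet (W : Set (Sym2 V))).edgeSet.ncard
        ≤ (W : Set (Sym2 V)).ncard := by
          rw [SimpleGraph.edgeSet_fromEdgeSet]
          exact Set.ncard_le_ncard Set.sdiff_subset W.finite_toSet
      _ = W.card := Set.ncard_coe_finset W
      _ ≤ U.card + (P.biUnion F).card := Finset.card_union_le _ _
      _ ≤ _ := by
        refine add_le_add ?_ (Finset.card_biUnion_le_card_mul _ _ _ fun p _ => hFc p)
        simpa using Finset.card_biUnion_le_card_mul (Finset.range (k + 1)) E _ fun i _ => hEc i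

/-! ### Choice of parameters -/

/-- The overhead factor of the preserver with `k + 1` levels. -/
noncomputable def overhead (k m n : ℕ) : ℝ :=
  (k + 1) * ((1 + Real.log n) * (n : ℝ) ^ (1 / k : ℝ) + 2) + hopBudget m k

/-- For fixed `k` and `m` the hop budget is a constant, and the logarithm is absorbed by a second
factor `n ^ (1 / k)`. -/
theorem eventually_overhead_le (k m : ℕ) (hk : 0 < k) :
    ∀ᶠ n : ℕ in atTop, overhead k m n ≤ (n : ℝ) ^ (2 / k : ℝ) := by
  have hk' : (0 : ℝ) < 1 / k := by positivity
  have h1 : (fun x : ℝ => (k + 1) * ((1 + Real.log x) * x ^ (1 / k : ℝ) + 2) + hopBudget m k)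
      =o[atTop] fun x : ℝ => x ^ (2 / k : ℝ) := by
    have hconst : ∀ c : ℝ, ∀ a > (0 : ℝ), (fun _ : ℝ => c) =o[atTop] fun x : ℝ => x ^ a := fun c a ha =>
      Asymptotics.isLittleO_const_left.2 (Or.inr
        (tendsto_norm_atTop_atTop.comp (tendsto_rpow_atTop ha)))
    have h2 : (fun x : ℝ => 1 + Real.log x) =o[atTop] fun x : ℝ => x ^ (1 / k : ℝ) :=
      (hconst 1 _ hk').add (isLittleO_log_rpow_atTop hk')
    have h3 : (fun x : ℝ => (1 + Real.log x) * x ^ (1 / k : ℝ)) =o[atTop]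
        fun x : ℝ => x ^ (2 / k : ℝ) := by
      refine (h2.mul_isBigO (Asymptotics.isBigO_refl (fun x : ℝ => x ^ (1 / k : ℝ)) atTop)).congr'
        EventuallyEq.rfl ?_
      filter_upwards [eventually_gt_atTop 0] with x hx
      rw [← Real.rpow_add hx]
      congr 1
      ring
    exact ((h3.add (hconst 2 _ (by positivity))).const_mul_left _).add (hconst _ _ (by positivity))
  have h4 := tendsto_natCast_atTop_atTop.eventually (h1.bound one_pos)
  filter_upwards [h4] with n hn
  rw [one_mul] at hn
  calc overhead k m n ≤ ‖overhead k m n‖ := Real.le_norm_self _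
    _ ≤ _ := hn
    _ = _ := by rw [Real.norm_of_nonneg]; positivity

/-- For `n ≥ 2` vertices, `k + 1` levels give a preserver of size at most
`overhead k m n * (n + p)`. -/
theorem exists_isPreserver_overhead {V : Type*} [Fintype V] (G : SimpleGraph V)
    (w : Sym2 V → ℝ≥0) (P : Finset (V × V)) (k m : ℕ) (ε : ℝ) (hε0 : 0 < ε) (hε1 : ε < 1)
    (hk : 0 < k) (hm : 8 * (k + 1) ≤ m * ε) (hV : 2 ≤ Fintype.card V) :
    ∃ H : SimpleGraph V, IsPreserver G w P ε H ∧
      (H.edgeSet.ncard : ℝ) ≤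
        overhead k m (Fintype.card V) * ((Fintype.card V : ℝ) + (P.card : ℝ)) := by
  set n := Fintype.card V with hn
  have hn1 : (1 : ℝ) < n := by exact_mod_cast hV
  have hk0 : (0 : ℝ) < k := by exact_mod_cast hk
  lift ε to ℝ≥0 using hε0.le
  have hlog : 0 ≤ Real.log n := Real.log_nonneg hn1.le
  set r : ℝ := (n : ℝ) ^ (1 / k : ℝ) with hr
  have hr1 : 1 < r := Real.one_lt_rpow hn1 (by positivity)
  obtain ⟨H, hH, hc⟩ := exists_isPreserver G w P k m ⌈(1 + Real.log n) * r⌉₊ (ε / (8 * (k + 1))) ε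
    (by
      rw [← mul_div_assoc, le_div_iff₀ (by positivity), one_mul]
      exact_mod_cast hm)
    (by rw [mul_div_cancel₀ _ (by positivity)])
    (by exact_mod_cast hε1.le)
    (Nat.ceil_pos.2 (by positivity)) r hr1
    (by rw [hr, ← Real.rpow_natCast, ← Real.rpow_mul (by positivity),
      one_div_mul_cancel hk0.ne', Real.rpow_one])
    (by
      refine le_trans ?_ (Nat.le_ceil _)
      gcongr
      exact harmonic_le_one_add_log _)
  refine ⟨H, hH, ?_⟩
  have hceil := (Nat.ceil_lt_add_one (a := (1 + Real.log n) * r) (by positivity)).le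
  calc (H.edgeSet.ncard : ℝ)
      ≤ (k + 1) * (n * (⌈(1 + Real.log n) * r⌉₊ + 1)) + P.card * hopBudget m k := by
        exact_mod_cast hc
    _ ≤ (k + 1) * (n * (((1 + Real.log n) * r + 1) + 1)) + P.card * hopBudget m k := by gcongr
    _ = (k + 1) * ((1 + Real.log n) * r + 2) * n + hopBudget m k * P.card := by ring
    _ ≤ ((k + 1) * ((1 + Real.log n) * r + 2) + hopBudget m k) * (n + P.card) := by
        have h1 : 0 ≤ (k + 1) * ((1 + Real.log n) * r + 2) * (P.card : ℝ) := by positivity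
        have h2 : 0 ≤ (hopBudget m k : ℝ) * n := by positivity
        linarith
    _ = _ := rfl

theorem card_edgeSet_le_sq {V : Type*} [Fintype V] (G : SimpleGraph V) :
    G.edgeSet.ncard ≤ Fintype.card V ^ 2 := by
  classical
  rw [← SimpleGraph.coe_edgeFinset, Set.ncard_coe_finset]
  exact G.card_edgeFinset_le_card_choose_two.trans (Nat.choose_le_pow _ _)

theorem mainTheorem3 (ε : ℝ) (hε0 : 0 < ε) (hε1 : ε < 1) :
    ∃ g : ℕ → ℝ, Tendsto g atTop (𝓝 0) ∧
      ∀ (V : Type*) [Fintype V] (G : SimpleGraph V) (w : Sym2 V → ℝ≥0) (P : Finset (V × V)),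
        ∃ H : SimpleGraph V, IsPreserver G w P ε H ∧
          (H.edgeSet.ncard : ℝ) ≤
            (Fintype.card V : ℝ) ^ g (Fintype.card V) * ((Fintype.card V : ℝ) + (P.card : ℝ)) := by
  classical
  let m : ℕ → ℕ := fun k => ⌈8 * (k + 1) / ε⌉₊
  have hm : ∀ k : ℕ, 8 * (k + 1) ≤ m k * ε := fun k =>
    (div_le_iff₀ hε0).1 (Nat.le_ceil (8 * ((k : ℝ) + 1) / ε))
  let good : ℕ → ℕ → Prop := fun n k => 2 ≤ n ∧ overhead k (m k) n ≤ (n : ℝ) ^ (2 / k : ℝ)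
  -- The largest admissible `k ≤ n`. The value 0 means that none was found; then all of `G` is kept,
  -- with exponent 1, since `n ^ 2 ≤ n * (n + p)`.
  let κ : ℕ → ℕ := fun n => Nat.findGreatest (good n) n
  have hκ : Tendsto κ atTop atTop := by
    refine tendsto_atTop.2 fun K => ?_
    filter_upwards [eventually_overhead_le (K + 1) (m (K + 1)) K.succ_pos,
      eventually_ge_atTop (K + 2)] with n hn hnK
    exact K.le_succ.trans (Nat.le_findGreatest (by omega) ⟨by omega, by exact_mod_cast hn⟩)
  refine ⟨fun n => if κ n = 0 then 1 else 2 / κ n, ?_, ?_⟩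
  · have h1 : Tendsto (fun n => (2 : ℝ) / κ n) atTop (𝓝 0) :=
      (tendsto_const_div_atTop_nhds_zero_nat 2).comp hκ
    refine h1.congr' ?_
    filter_upwards [hκ.eventually_gt_atTop 0] with n hn
    rw [if_neg hn.ne']
  · intro V _ G w P
    by_cases h0 : κ (Fintype.card V) = 0
    · refine ⟨G, ⟨le_rfl, fun u v _ => ?_⟩, ?_⟩
      · refine le_mul_of_one_le_left zero_le ?_
        rw [ENNReal.one_le_ofReal]
        linarith
      · simp only [h0, if_true, Real.rpow_one]
        have h1 : (G.edgeSet.ncard : ℝ) ≤ (Fintype.card V : ℝ) ^ 2 := by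
          exact_mod_cast card_edgeSet_le_sq G
        have h2 : (0 : ℝ) ≤ Fintype.card V * P.card := by positivity
        nlinarith
    · obtain ⟨hn2, hov⟩ : good (Fintype.card V) (κ (Fintype.card V)) :=
        Nat.findGreatest_of_ne_zero rfl h0
      obtain ⟨H, hH, hc⟩ := exists_isPreserver_overhead G w P (κ (Fintype.card V)) _ ε hε0 hε1
        (Nat.pos_of_ne_zero h0) (hm _) hn2
      refine ⟨H, hH, hc.trans ?_⟩
      simp only [h0, if_false]
      gcongr
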